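/- Let $\mathcal{A}$ be a semi-abelian category, that is, a category with a zero object, finite limits and binary coproducts which is Barr exact (kernel pairs have coequalizers, regular epimorphisms are stable under pullback, and every internal equivalence relation is a kernel pair) and Bourn protomodular (given a commutative diagram formed by two horizontally adjacent squares whose middle vertical arrow is a split epimorphism, if the left-hand square and the outer rectangle are pullbacks, then so is the right-hand square). Let $A$ be a simplicial object in $\mathcal{A}$, with face morphisms $\partial_i\colon A_n\to A_{n-1}$ for $0\le i\le n$. Its Moore complex $N(A)$ is the chain complex with $N_0A=A_0$ and $N_nA=\bigcap_{i=0}^{n-1}\ker(\partial_i\colon A_n\to A_{n-1})$ for $n\ge 1$, and with boundary operator $d_n\colon N_nA\to N_{n-1}A$ induced by $\partial_n$. For $n\ge 1$, the homology object $H_nA$ is the cokernel of the morphism $N_{n+1}A\to\ker(d_n)$ induced by $d_{n+1}$. An object $X$ of $\mathcal{A}$ is called abelian if there is a morphism $\varphi\colon X\times X\to X$ with $\varphi\circ(1_X,0)=1_X=\varphi\circ(0,1_X)$. Then, for every $n\ge 1$, the homology object $H_nA$ exists and is an abelian object of $\mathcal{A}$. -/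

import Mathlib

open CategoryTheory CategoryTheory.Limits Opposite Simplicial

universe v u

/-- A finitely complete category is *(Bourn) protomodular* when, given a commutative diagram
```
  X --f--> Y --g--> Z
  |x       |y       |z
  v        v        v
  X' -f'-> Y' -g'-> Z'
```
in which `y` is a split epimorphism, if the left hand square and the outer rectangle are pullbacks,
then so is the right hand square. -/
class IsProtomodular (C : Type u) [Category.{v} C] : Prop where
  isPullback_right {X Y Z X' Y' Z' : C} {f : X ⟶ Y} {g : Y ⟶ Z} {f' : X' ⟶ Y'} {g' : Y' ⟶ Z'}
    {x : X ⟶ X'} {y : Y ⟶ Y'} {z : Z ⟶ Z'} :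
    IsSplitEpi y → CommSq g y z g' → IsPullback f x y f' →
      IsPullback (f ≫ g) x z (f' ≫ g') → IsPullback g y z g'

/-- A regular category is *(Barr) exact* when every internal equivalence relation in it is the
kernel pair of some morphism. -/
class IsBarrExact (C : Type u) [Category.{v} C] : Prop extends Regular C where
  exists_isKernelPair {R X : C} (p₁ p₂ : R ⟶ X) :
    IsEquivalenceRelation p₁ p₂ → ∃ (Y : C) (q : X ⟶ Y), IsKernelPair q p₁ p₂

/-- A category is *semi-abelian* when it is pointed, Barr exact and protomodular and has binary
coproducts. Pointedness is the existence of a zero object; the (uniquely determined) family of zero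
morphisms is carried by the instance argument `HasZeroMorphisms C`. -/
class IsSemiAbelian (C : Type u) [Category.{v} C] [HasZeroMorphisms C] : Prop
    extends IsBarrExact C, IsProtomodular C where
  hasZeroObject : HasZeroObject C
  hasBinaryCoproducts : HasBinaryCoproducts C

section AbelianObject

variable {C : Type u} [Category.{v} C] [HasZeroMorphisms C] [HasBinaryProducts C]

/-- Two morphisms `k : K ⟶ X` and `k' : K' ⟶ X` *cooperate* when there is a morphism
`φ : K ⨯ K' ⟶ X` with `φ ∘ (1, 0) = k` and `φ ∘ (0, 1) = k'`. -/
def Cooperate {K K' X : C} (k : K ⟶ X) (k' : K' ⟶ X) : Prop :=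
  ∃ φ : K ⨯ K' ⟶ X, prod.lift (𝟙 K) 0 ≫ φ = k ∧ prod.lift 0 (𝟙 K') ≫ φ = k'

/-- An object `X` is *abelian* when its identity morphism cooperates with itself. -/
def IsAbelianObject (X : C) : Prop :=
  Cooperate (𝟙 X) (𝟙 X)

end AbelianObject

namespace Moore

variable {C : Type u} [Category.{v} C] [HasZeroMorphisms C] [HasFiniteLimits C]

/-- The objects of the Moore complex of `A`: `N₀ A = A₀`, and for `n ≥ 1` the object `Nₙ A` is the
kernel of `(∂₀, …, ∂ₙ₋₁) : Aₙ ⟶ (Aₙ₋₁)ⁿ`, i.e. the intersection of the kernels of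
`∂₀, …, ∂ₙ₋₁ : Aₙ ⟶ Aₙ₋₁`. -/
noncomputable def N (A : SimplicialObject C) (n : ℕ) : C :=
  match n with
  | 0 => A _⦋0⦌
  | n + 1 => kernel (Pi.lift fun i : Fin (n + 1) => A.δ (n := n) i.castSucc)

/-- The inclusion `Nₙ A ⟶ Aₙ`. -/
noncomputable def ι (A : SimplicialObject C) (n : ℕ) : N A n ⟶ A _⦋n⦌ :=
  match n with
  | 0 => 𝟙 _
  | n + 1 => kernel.ι (Pi.lift fun i : Fin (n + 1) => A.δ (n := n) i.castSucc)

instance (A : SimplicialObject C) (n : ℕ) : Mono (ι A n) := by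
  cases n <;> (dsimp only [ι, N]; infer_instance)

lemma ι_δ (A : SimplicialObject C) (n : ℕ) (i : Fin (n + 1)) :
    ι A (n + 1) ≫ A.δ i.castSucc = 0 := by
  have h := congrArg (fun t => t ≫ Pi.π (fun _ : Fin (n + 1) => A _⦋n⦌) i)
    (kernel.condition (Pi.lift fun i : Fin (n + 1) => A.δ (n := n) i.castSucc))
  rwa [Category.assoc, Pi.lift_π, zero_comp] at h

/-- The composite `∂ₙ₊₁ ∘ ι : Nₙ₊₁ A ⟶ Aₙ` is annihilated by `∂₀, …, ∂ₙ₋₁`. -/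
lemma ι_δ_last_δ (A : SimplicialObject C) (n : ℕ) (i : Fin (n + 1)) :
    (ι A (n + 2) ≫ A.δ (Fin.last (n + 2))) ≫ A.δ i.castSucc = 0 := by
  have h := A.δ_comp_δ (n := n) (i := i.castSucc) (j := Fin.last (n + 1)) (Fin.le_last _)
  rw [Fin.succ_last] at h
  rw [Category.assoc, h, ← Category.assoc, ι_δ, zero_comp]

/-- The boundary operator `dₙ₊₁ : Nₙ₊₁ A ⟶ Nₙ A`: the factorization through `ι : Nₙ A ⟶ Aₙ` of
`∂ₙ₊₁ ∘ ι : Nₙ₊₁ A ⟶ Aₙ`. -/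
noncomputable def d (A : SimplicialObject C) (n : ℕ) : N A (n + 1) ⟶ N A n :=
  match n with
  | 0 => ι A 1 ≫ A.δ (Fin.last 1)
  | n + 1 => kernel.lift (Pi.lift fun i : Fin (n + 1) => A.δ (n := n) i.castSucc)
      (ι A (n + 2) ≫ A.δ (Fin.last (n + 2))) (by
      refine Limits.Pi.hom_ext _ _ fun i => ?_
      rw [Category.assoc, Pi.lift_π, zero_comp]
      exact ι_δ_last_δ A n i)

lemma d_ι (A : SimplicialObject C) (n : ℕ) :
    d A n ≫ ι A n = ι A (n + 1) ≫ A.δ (Fin.last (n + 1)) := by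
  cases n with
  | zero => exact Category.comp_id _
  | succ n => exact kernel.lift_ι _ _ _

lemma d_comp_d (A : SimplicialObject C) (n : ℕ) : d A (n + 1) ≫ d A n = 0 := by
  have h := A.δ_comp_δ_self (n := n) (i := Fin.last (n + 1))
  rw [Fin.succ_last] at h
  rw [← cancel_mono (ι A n), Category.assoc, d_ι, ← Category.assoc, d_ι, Category.assoc, ← h,
    ← Category.assoc, ι_δ, zero_comp, zero_comp]

/-- The *Moore complex* `N(A)` of a simplicial object `A`. -/
noncomputable def complex (A : SimplicialObject C) : ChainComplex C ℕ :=
  ChainComplex.of (N A) (d A) (d_comp_d A)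

/-- The short complex `Nₙ₊₁ A ⟶ Nₙ A ⟶ Nₙ₋₁ A` around degree `n` of the Moore complex of `A`
(for `n = 0` the second morphism is zero).

A `LeftHomologyData` for it consists of a kernel `K` of `dₙ` and a cokernel `H` of the morphism
`Nₙ₊₁ A ⟶ K` induced by `dₙ₊₁`: its object `H` is the `n`-th homology object `Hₙ A` of `A`. -/
noncomputable abbrev sc (A : SimplicialObject C) (n : ℕ) : ShortComplex C :=
  (complex A).sc n

end Moore

/-- `Hₙ A`, the *`n`-th homology object* of a simplicial object `A`: the cokernel of the morphism
`Nₙ₊₁ A ⟶ K[dₙ]` induced by the boundary operator `dₙ₊₁` of the Moore complex of `A`. -/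
noncomputable def homologyObject {C : Type u} [Category.{v} C] [HasZeroMorphisms C]
    [HasFiniteLimits C] (A : SimplicialObject C) (n : ℕ) [(Moore.sc A n).HasLeftHomology] : C :=
  (Moore.sc A n).leftHomology

-- Let Z ⊂ Aₙ₊₁ be the cycles (all faces zero) and W ⊂ Aₙ₊₂ the elements whose faces 0, …, n vanish
-- and whose last two faces are cycles. Those two faces form a reflexive graph on Z, split by σₙ₊₁.
-- Its image in Z × Z is an equivalence relation because protomodular categories are Mal'tsev, so
-- exactness gives a coequalizer q : Z ⟶ H. The kernel of the first leg is Nₙ₊₂A, and a split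
-- epimorphism's kernel and section are jointly epic, so q is also the cokernel of Nₙ₊₂A ⟶ Z.
--
-- For abelianness, let T ⊂ Aₙ₊₂ be the elements whose faces below n vanish and whose last three
-- faces (x, y, z) are cycles. Degenerate cycles give the triples (0, c, c) and (c, c, 0), so (z, x)
-- : T ⟶ Z × Z is a regular epimorphism. A triple (0, y, 0) lies in W and relates y to 0, so q(y) =
-- 0. Hence q(y) factors through (z, x), which makes q cooperate with itself, and this passes to the
-- quotient H. Positive degree provides the two distinct degeneracies.

attribute [local simp] prod.lift_fst prod.lift_snd prod.lift_fst_assoc prod.lift_snd_assoc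
  prod.map_fst prod.map_snd prod.map_fst_assoc prod.map_snd_assoc pullback.lift_fst
  pullback.lift_snd pullback.lift_fst_assoc pullback.lift_snd_assoc Pi.lift_π Pi.lift_π_assoc

/-! ### Mal'tsev property and reflexive coequalizers -/

section Protomodular

variable {C : Type u} [Category.{v} C]

/-- In a protomodular category, a split epimorphism's section and any pullback of it are jointly
extremally epimorphic. -/
lemma IsProtomodular.isIso_of_isPullback [IsProtomodular C] {F E B B' M : C} {k : F ⟶ E}
    {q : F ⟶ B'} {p : E ⟶ B} {b : B' ⟶ B} (sq : IsPullback k q p b) {s : B ⟶ E}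
    (hs : s ≫ p = 𝟙 B) (i : M ⟶ E) [Mono i] {k' : F ⟶ M} (hk : k' ≫ i = k) {s' : B ⟶ M}
    (hs' : s' ≫ i = s) : IsIso i := by
  have hsplit : IsSplitEpi (i ≫ p) := ⟨⟨⟨s', by rw [← Category.assoc, hs', hs]⟩⟩⟩
  have outer : IsPullback (k' ≫ i) q p (b ≫ 𝟙 B) := by simpa [hk] using sq
  have left : IsPullback k' q (i ≫ p) b := by
    refine IsPullback.of_isLimit' ⟨by rw [← Category.assoc, hk, sq.w]⟩
      (PullbackCone.IsLimit.mk _ (fun c => sq.lift (c.fst ≫ i) c.snd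
        (by rw [Category.assoc, c.condition])) (fun c => ?_) (fun c => ?_) (fun c t ht₁ ht₂ => ?_))
    · rw [← cancel_mono i, Category.assoc, hk, sq.lift_fst]
    · exact sq.lift_snd _ _ _
    · apply sq.hom_ext
      · rw [sq.lift_fst, ← hk, ← Category.assoc, ht₁]
      · rw [sq.lift_snd, ht₂]
  exact (IsProtomodular.isPullback_right hsplit ⟨by simp⟩ left outer).isIso_fst_of_isIso

/-- In a protomodular category every relation is difunctional. -/
lemma IsProtomodular.exists_difunctional [HasFiniteLimits C] [IsProtomodular C] {R X Y : C}
    (p₁ : R ⟶ X) (p₂ : R ⟶ Y) [JointlyMono₂ p₁ p₂] {T : C} (a b c : T ⟶ R)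
    (hab : a ≫ p₂ = b ≫ p₂) (hbc : b ≫ p₁ = c ≫ p₁) :
    ∃ t : T ⟶ R, t ≫ p₁ = a ≫ p₁ ∧ t ≫ p₂ = c ≫ p₂ := by
  have hm : Mono (prod.lift p₁ p₂) := ⟨fun f g h => JointlyMono₂.right_cancellation (p₁ := p₁)
    (p₂ := p₂) f g (by simpa using h =≫ prod.fst) (by simpa using h =≫ prod.snd)⟩
  -- P consists of triples (a, b, c) with a, b agreeing under `p₂` and b, c under `p₁`. The section
  -- `s` is (a, b) ↦ (a, b, b), and `e` is (b, c) ↦ (b, b, c).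
  let P := pullback (pullback.snd p₂ p₂) (pullback.fst p₁ p₁)
  let π₁ : P ⟶ pullback p₂ p₂ := pullback.fst _ _
  let π₂ : P ⟶ pullback p₁ p₁ := pullback.snd _ _
  let δ : R ⟶ pullback p₂ p₂ := pullback.lift (𝟙 R) (𝟙 R) rfl
  let s : pullback p₂ p₂ ⟶ P := pullback.lift (𝟙 _)
    (pullback.lift (pullback.snd p₂ p₂) (pullback.snd p₂ p₂) rfl) (by simp)
  let e : pullback p₁ p₁ ⟶ P := pullback.lift (pullback.fst p₁ p₁ ≫ δ) (𝟙 _) (by simp [δ])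
  have sq : IsPullback e (pullback.fst p₁ p₁) π₁ δ := by
    refine IsPullback.of_right (h₁₂ := π₂) (h₂₂ := pullback.snd p₂ p₂)
      (v₁₃ := pullback.fst p₁ p₁) ?_ (by simp [e, π₁]) (IsPullback.of_hasPullback _ _).flip
    have h₁ : e ≫ π₂ = 𝟙 _ := by simp [e, π₂]
    have h₂ : δ ≫ pullback.snd p₂ p₂ = 𝟙 _ := by simp [δ]
    rw [h₁, h₂]
    exact IsPullback.of_horiz_isIso ⟨by simp⟩
  let u : P ⟶ X := π₁ ≫ pullback.fst p₂ p₂ ≫ p₁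
  let v : P ⟶ Y := π₂ ≫ pullback.snd p₁ p₁ ≫ p₂
  -- The subobject of triples for which (p₁ a, p₂ c) lies in R. It contains the images of `s`
  -- (witness a) and `e` (witness c), so it is all of P.
  let i := pullback.snd (prod.lift p₁ p₂) (prod.lift u v)
  have hi : IsIso i := by
    refine IsProtomodular.isIso_of_isPullback sq (s := s) (by simp [s, π₁]) i
      (k' := pullback.lift (pullback.snd p₁ p₁) e ?_)
      (s' := pullback.lift (pullback.fst p₂ p₂) s ?_)
      (pullback.lift_snd _ _ _) (pullback.lift_snd _ _ _)
    · ext <;> simp [u, v, e, π₁, π₂, δ, pullback.condition]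
    · ext <;> simp [u, v, s, π₁, π₂, pullback.condition]
  have hw : inv i ≫ pullback.fst (prod.lift p₁ p₂) (prod.lift u v) ≫ prod.lift p₁ p₂ =
      prod.lift u v := by
    rw [pullback.condition]; exact IsIso.inv_hom_id_assoc i _
  let x : T ⟶ P := pullback.lift (pullback.lift a b hab) (pullback.lift b c hbc) (by simp)
  refine ⟨x ≫ inv i ≫ pullback.fst (prod.lift p₁ p₂) (prod.lift u v), ?_, ?_⟩
  · have := x ≫= (hw =≫ prod.fst)
    simp only [Category.assoc, prod.lift_fst] at this ⊢
    rw [this]; simp [x, u, π₁]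
  · have := x ≫= (hw =≫ prod.snd)
    simp only [Category.assoc, prod.lift_snd] at this ⊢
    rw [this]; simp [x, v, π₂]

/-- A protomodular category is a Mal'tsev category: every reflexive relation is an equivalence
relation. -/
lemma IsProtomodular.isEquivalenceRelation [HasFiniteLimits C] [IsProtomodular C] {R X : C}
    {p₁ p₂ : R ⟶ X} (h : ReflexiveRelation p₁ p₂) : IsEquivalenceRelation p₁ p₂ := by
  have := h.toJointlyMono₂
  -- Symmetry: (y, y), (x, y), (x, x) yield (y, x). Transitivity: (x, y), (y, y), (y, z) yield (x,
  -- z).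
  obtain ⟨s, hs₁, hs₂⟩ := exists_difunctional p₁ p₂ (p₂ ≫ h.r) (𝟙 R) (p₁ ≫ h.r)
    (by simp) (by simp)
  obtain ⟨t, ht₁, ht₂⟩ := exists_difunctional p₁ p₂ (pullback.fst p₂ p₁)
    (pullback.fst p₂ p₁ ≫ p₂ ≫ h.r) (pullback.snd p₂ p₁) (by simp)
    (by simp [pullback.condition])
  exact ⟨⟨{
    toReflexiveRelation := h
    s := s
    symmetry₁ := by simpa using hs₁
    symmetry₂ := by simpa using hs₂
    c := _
    isLimit := pullback.isLimit p₂ p₁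
    t := t
    transitivity₁ := ht₁
    transitivity₂ := ht₂ }⟩⟩

/-- In an exact protomodular category reflexive graphs have coequalizers. -/
lemma IsBarrExact.exists_coequalizer_of_reflexive [IsBarrExact C] [IsProtomodular C] {W Z : C}
    (d c : W ⟶ Z) (s : Z ⟶ W) (hd : s ≫ d = 𝟙 Z) (hc : s ≫ c = 𝟙 Z) :
    ∃ (H : C) (q : Z ⟶ H), IsRegularEpi q ∧ d ≫ q = c ≫ q ∧
      ∀ {Y : C} (f : Z ⟶ Y), d ≫ f = c ≫ f → ∃ g : H ⟶ Y, q ≫ g = f := by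
  let F := Regular.strongEpiMonoFactorisation (prod.lift d c)
  have hF : F.e ≫ F.m = prod.lift d c := F.fac
  have hF₁ : F.e ≫ F.m ≫ prod.fst = d := by rw [← Category.assoc, hF, prod.lift_fst]
  have hF₂ : F.e ≫ F.m ≫ prod.snd = c := by rw [← Category.assoc, hF, prod.lift_snd]
  have hrel : IsEquivalenceRelation (F.m ≫ prod.fst) (F.m ≫ prod.snd) :=
    IsProtomodular.isEquivalenceRelation
      { right_cancellation := fun Y f g h₁ h₂ => by
          rw [← cancel_mono F.m]
          ext
          · simpa using h₁
          · simpa using h₂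
        r := s ≫ F.e
        reflexivity₁ := by rw [Category.assoc, hF₁, hd]
        reflexivity₂ := by rw [Category.assoc, hF₂, hc] }
  obtain ⟨Y, q₀, hq₀⟩ := IsBarrExact.exists_isKernelPair _ _ hrel
  -- `q₀` need not be epi; its image part has the same kernel pair and is a regular epimorphism.
  let G := Regular.strongEpiMonoFactorisation q₀
  have hG : G.e ≫ G.m = q₀ := G.fac
  have hq : IsKernelPair G.e (F.m ≫ prod.fst) (F.m ≫ prod.snd) := by
    rw [← hG] at hq₀
    exact hq₀.cancel_right_of_mono
  have hreg : IsRegularEpi G.e :=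
    inferInstanceAs (IsRegularEpi (Regular.strongEpiMonoFactorisation q₀).e)
  refine ⟨G.I, G.e, hreg, ?_, fun f hf => ?_⟩
  · have h := F.e ≫= hq.w
    rwa [← Category.assoc, hF₁, ← Category.assoc, hF₂] at h
  · obtain ⟨g, hg⟩ := Cofork.IsColimit.desc' hq.toCoequalizer' f (by
      rw [← cancel_epi F.e, ← Category.assoc, hF₁, ← Category.assoc, hF₂, hf])
    exact ⟨g, hg⟩

end Protomodular

/-! ### Kernels and sections in the pointed case -/

section Pointed

variable {C : Type u} [Category.{v} C] [HasZeroMorphisms C]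

open ZeroObject in
/-- In a pointed protomodular category, the kernel and the section of a split epimorphism are
jointly extremally epimorphic. -/
lemma IsProtomodular.isIso_of_kernel [HasZeroObject C] [IsProtomodular C] {E B M : C} {p : E ⟶ B}
    [HasKernel p] {s : B ⟶ E} (hs : s ≫ p = 𝟙 B) (i : M ⟶ E) [Mono i] {k' : kernel p ⟶ M}
    (hk : k' ≫ i = kernel.ι p) {s' : B ⟶ M} (hs' : s' ≫ i = s) : IsIso i := by
  have sq : IsPullback (kernel.ι p) (0 : kernel p ⟶ 0) p (0 : (0 : C) ⟶ B) :=
    IsPullback.of_isLimit' ⟨by simp⟩ (PullbackCone.IsLimit.mk _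
      (fun c => kernel.lift p c.fst (by rw [c.condition, comp_zero]))
      (fun c => kernel.lift_ι _ _ _) (fun c => Subsingleton.elim _ _)
      (fun c t ht _ => by rw [← cancel_mono (kernel.ι p), ht, kernel.lift_ι]))
  exact isIso_of_isPullback sq hs i hk hs'

variable [HasZeroObject C] [HasFiniteLimits C] [IsProtomodular C]

/-- Morphisms out of the domain of a split epimorphism are determined by their restrictions to the
kernel and to the section. -/
lemma IsProtomodular.hom_ext {E B Y : C} {p : E ⟶ B} {s : B ⟶ E} (hs : s ≫ p = 𝟙 B) {f g : E ⟶ Y}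
    (hk : kernel.ι p ≫ f = kernel.ι p ≫ g) (h : s ≫ f = s ≫ g) : f = g := by
  have : IsIso (equalizer.ι f g) := isIso_of_kernel hs _ (equalizer.lift_ι _ hk)
    (equalizer.lift_ι _ h)
  rw [← cancel_epi (equalizer.ι f g), equalizer.condition]

/-- A pointed protomodular category is unital. -/
lemma IsProtomodular.isIso_of_prod {X Y M : C} (i : M ⟶ X ⨯ Y) [Mono i] {a : X ⟶ M} {b : Y ⟶ M}
    (ha : a ≫ i = prod.lift (𝟙 X) 0) (hb : b ≫ i = prod.lift 0 (𝟙 Y)) : IsIso i := by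
  refine isIso_of_kernel (p := (prod.fst : X ⨯ Y ⟶ X)) (s := prod.lift (𝟙 X) 0) (by simp) i
    (k' := kernel.ι prod.fst ≫ prod.snd ≫ b) ?_ ha
  ext <;> simp [hb]

lemma IsProtomodular.prod_hom_ext {X Y Z : C} {f g : X ⨯ Y ⟶ Z}
    (h₁ : prod.lift (𝟙 X) 0 ≫ f = prod.lift (𝟙 X) 0 ≫ g)
    (h₂ : prod.lift 0 (𝟙 Y) ≫ f = prod.lift 0 (𝟙 Y) ≫ g) : f = g := by
  have : IsIso (equalizer.ι f g) := isIso_of_prod _ (equalizer.lift_ι _ h₁)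
    (equalizer.lift_ι _ h₂)
  rw [← cancel_epi (equalizer.ι f g), equalizer.condition]

/-- In a pointed protomodular category a regular epimorphism is the cokernel of its kernel. -/
lemma IsProtomodular.exists_desc {X Y Z : C} (f : X ⟶ Y) [IsRegularEpi f] (g : X ⟶ Z)
    (hg : kernel.ι f ≫ g = 0) : ∃ h : Y ⟶ Z, f ≫ h = g := by
  -- The first projection of the kernel pair is split by the diagonal, and its kernel maps into that
  -- of `f`.
  have key : pullback.fst f f ≫ g = pullback.snd f f ≫ g := by
    refine hom_ext (p := pullback.fst f f) (s := pullback.lift (𝟙 X) (𝟙 X) rfl) (by simp) ?_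
      (by simp)
    have h : (kernel.ι (pullback.fst f f) ≫ pullback.snd f f) ≫ f = 0 := by
      rw [Category.assoc, ← pullback.condition, kernel.condition_assoc, zero_comp]
    rw [kernel.condition_assoc, zero_comp, ← Category.assoc, ← kernel.lift_ι f _ h,
      Category.assoc, hg, comp_zero]
  obtain ⟨h, hh⟩ := Cofork.IsColimit.desc' (IsKernelPair.of_hasPullback f).toCoequalizer' g key
  exact ⟨h, hh⟩

end Pointed

/-! ### Regular epimorphisms onto products and abelian quotients -/

section RegularPointed

variable {C : Type u} [Category.{v} C] [HasZeroMorphisms C] [HasZeroObject C] [Regular C]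
  [IsProtomodular C]

lemma IsProtomodular.isRegularEpi_of_prod {X Y T : C} (f : T ⟶ X ⨯ Y) {a : X ⟶ T} {b : Y ⟶ T}
    (ha : a ≫ f = prod.lift (𝟙 X) 0) (hb : b ≫ f = prod.lift 0 (𝟙 Y)) : IsRegularEpi f := by
  have : ExtremalEpi f := ExtremalEpi.mk_of_hasEqualizers _ fun Z p i fac _ =>
    isIso_of_prod i (a := a ≫ p) (b := b ≫ p) (by rw [Category.assoc, fac, ha])
      (by rw [Category.assoc, fac, hb])
  infer_instance

lemma IsProtomodular.isRegularEpi_prod_map {X Y X' Y' : C} (f : X ⟶ X') (g : Y ⟶ Y')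
    [IsRegularEpi f] [IsRegularEpi g] : IsRegularEpi (prod.map f g) := by
  have : ExtremalEpi (prod.map f g) := ExtremalEpi.mk_of_hasEqualizers _ fun Z p i fac _ => by
    have sq₁ : CommSq (prod.lift (𝟙 X) 0 ≫ p) f i (prod.lift (𝟙 X') 0) :=
      ⟨by rw [Category.assoc, fac]; ext <;> simp⟩
    have sq₂ : CommSq (prod.lift 0 (𝟙 Y) ≫ p) g i (prod.lift 0 (𝟙 Y')) :=
      ⟨by rw [Category.assoc, fac]; ext <;> simp⟩
    exact isIso_of_prod i sq₁.fac_right sq₂.fac_right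
  infer_instance

/-- If a regular epimorphism cooperates with itself, then its codomain is abelian. -/
lemma Cooperate.isAbelianObject {Z H : C} {q : Z ⟶ H} [IsRegularEpi q] (h : Cooperate q q) :
    IsAbelianObject H := by
  obtain ⟨φ, h₁, h₂⟩ := h
  have := IsProtomodular.isRegularEpi_prod_map q q
  have hφ : prod.map (kernel.ι q) (kernel.ι q) ≫ φ = 0 := by
    apply IsProtomodular.prod_hom_ext
    · have : prod.lift (𝟙 _) 0 ≫ prod.map (kernel.ι q) (kernel.ι q) =
          kernel.ι q ≫ prod.lift (𝟙 Z) 0 := by ext <;> simp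
      rw [← Category.assoc, this, Category.assoc, h₁, kernel.condition, comp_zero]
    · have : prod.lift 0 (𝟙 _) ≫ prod.map (kernel.ι q) (kernel.ι q) =
          kernel.ι q ≫ prod.lift 0 (𝟙 Z) := by ext <;> simp
      rw [← Category.assoc, this, Category.assoc, h₂, kernel.condition, comp_zero]
  obtain ⟨ψ, hψ⟩ := IsProtomodular.exists_desc (prod.map q q) φ (by
    have hk₁ : (kernel.ι (prod.map q q) ≫ prod.fst) ≫ q = 0 := by
      rw [Category.assoc, ← prod.map_fst q q, kernel.condition_assoc, zero_comp]
    have hk₂ : (kernel.ι (prod.map q q) ≫ prod.snd) ≫ q = 0 := by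
      rw [Category.assoc, ← prod.map_snd q q, kernel.condition_assoc, zero_comp]
    have e : kernel.ι (prod.map q q) = prod.lift
        (kernel.lift q (kernel.ι (prod.map q q) ≫ prod.fst) hk₁)
        (kernel.lift q (kernel.ι (prod.map q q) ≫ prod.snd) hk₂) ≫
          prod.map (kernel.ι q) (kernel.ι q) := by
      ext <;> simp
    rw [e, Category.assoc, hφ, comp_zero])
  refine ⟨ψ, ?_, ?_⟩
  · have : q ≫ prod.lift (𝟙 H) 0 = prod.lift (𝟙 Z) 0 ≫ prod.map q q := by ext <;> simp
    rw [← cancel_epi q, ← Category.assoc, this, Category.assoc, hψ, h₁, Category.comp_id]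
  · have : q ≫ prod.lift 0 (𝟙 H) = prod.lift 0 (𝟙 Z) ≫ prod.map q q := by ext <;> simp
    rw [← cancel_epi q, ← Category.assoc, this, Category.assoc, hψ, h₂, Category.comp_id]

end RegularPointed

lemma IsAbelianObject.of_iso {C : Type u} [Category.{v} C] [HasZeroMorphisms C]
    [HasBinaryProducts C] {X Y : C} (e : X ≅ Y) (h : IsAbelianObject X) : IsAbelianObject Y := by
  obtain ⟨φ, h₁, h₂⟩ := h
  refine ⟨prod.map e.inv e.inv ≫ φ ≫ e.hom, ?_, ?_⟩
  · have : prod.lift (𝟙 Y) 0 ≫ prod.map e.inv e.inv = e.inv ≫ prod.lift (𝟙 X) 0 := by ext <;> simp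
    rw [← Category.assoc, this, Category.assoc, reassoc_of% h₁, e.inv_hom_id]
  · have : prod.lift 0 (𝟙 Y) ≫ prod.map e.inv e.inv = e.inv ≫ prod.lift 0 (𝟙 X) := by ext <;> simp
    rw [← Category.assoc, this, Category.assoc, reassoc_of% h₂, e.inv_hom_id]

/-- The joint kernel of two finite families of morphisms. -/
lemma exists_joint_kernel {C : Type u} [Category.{v} C] [HasZeroMorphisms C] [HasFiniteLimits C]
    {ι κ : Type} [Finite ι] [Finite κ] {X Y Z : C} (f : ι → (X ⟶ Y)) (g : κ → (X ⟶ Z)) :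
    ∃ (K : C) (k : K ⟶ X), Mono k ∧ (∀ i, k ≫ f i = 0) ∧ (∀ j, k ≫ g j = 0) ∧
      ∀ {T : C} (t : T ⟶ X), (∀ i, t ≫ f i = 0) → (∀ j, t ≫ g j = 0) → ∃ l, l ≫ k = t := by
  let F := prod.lift (Pi.lift f) (Pi.lift g)
  refine ⟨kernel F, kernel.ι F, inferInstance, fun i => ?_, fun j => ?_, fun t hf hg =>
    ⟨kernel.lift F t ?_, kernel.lift_ι _ _ _⟩⟩
  · simpa [F] using kernel.condition F =≫ (prod.fst ≫ Pi.π _ i)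
  · simpa [F] using kernel.condition F =≫ (prod.snd ≫ Pi.π _ j)
  · ext i <;> simp [F, hf, hg]

/-! ### Faces, degeneracies and cycles -/

namespace Moore

variable {C : Type u} [Category.{v} C]

/-- Conditions on index values spare the callers any matching of `Fin` casts. -/
lemma δ_comp_δ_of_val (A : SimplicialObject C) {n : ℕ} {j i' : Fin (n + 3)} {i j' : Fin (n + 2)}
    (hi : i'.val = i.val) (hj : j.val = j'.val + 1) (h : i.val ≤ j'.val) :
    A.δ j ≫ A.δ i = A.δ i' ≫ A.δ j' := by
  obtain rfl : i' = i.castSucc := Fin.ext hi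
  obtain rfl : j = j'.succ := Fin.ext hj
  exact A.δ_comp_δ h

lemma comp_σ_comp_δ (A : SimplicialObject C) {n : ℕ} {X : C} (z : X ⟶ A _⦋n⦌)
    {j : Fin (n + 1)} {i : Fin (n + 2)} (h : i = j.castSucc ∨ i = j.succ) :
    (z ≫ A.σ j) ≫ A.δ i = z := by
  rw [Category.assoc]
  rcases h with rfl | rfl
  · rw [A.δ_comp_σ_self, Category.comp_id]
  · rw [A.δ_comp_σ_succ, Category.comp_id]

variable [HasZeroMorphisms C]

/-- All but two faces of a degeneracy of a cycle vanish. -/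
lemma comp_σ_comp_δ_eq_zero (A : SimplicialObject C) {n : ℕ} {X : C} {z : X ⟶ A _⦋n + 1⦌}
    (hz : ∀ i, z ≫ A.δ i = 0) {j : Fin (n + 2)} {i : Fin (n + 3)} (h₁ : i ≠ j.castSucc)
    (h₂ : i ≠ j.succ) : (z ≫ A.σ j) ≫ A.δ i = 0 := by
  rw [Category.assoc]
  rcases lt_or_gt_of_ne h₁ with h | h
  · obtain ⟨j', rfl⟩ : ∃ j' : Fin (n + 1), j = j'.succ :=
      Fin.exists_succ_eq.2 (by rintro rfl; simp at h) |>.imp fun _ => Eq.symm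
    obtain ⟨i', rfl⟩ : ∃ i' : Fin (n + 2), i = i'.castSucc :=
      Fin.exists_castSucc_eq.2 (fun e => by
        subst e; exact absurd h (not_lt.2 (Fin.le_last _))) |>.imp fun _ => Eq.symm
    rw [A.δ_comp_σ_of_le (by simpa [Fin.le_def, Fin.lt_def, Nat.lt_succ_iff] using h),
      ← Category.assoc, hz, zero_comp]
  · have h' : j.succ < i := lt_of_le_of_ne (Fin.castSucc_lt_iff_succ_le.1 h) h₂.symm
    rw [A.δ_comp_σ_of_gt' h', ← Category.assoc, hz, zero_comp]

variable [HasFiniteLimits C]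

lemma exists_lift_ι (A : SimplicialObject C) (n : ℕ) {T : C} (t : T ⟶ A _⦋n + 1⦌)
    (ht : ∀ i : Fin (n + 1), t ≫ A.δ i.castSucc = 0) : ∃ l, l ≫ ι A (n + 1) = t :=
  ⟨kernel.lift _ t (by
    refine Limits.Pi.hom_ext _ _ fun i => ?_
    rw [Category.assoc, Pi.lift_π, zero_comp]
    exact ht i), kernel.lift_ι _ _ _⟩

/-- The inclusion of the cycles in `Aₙ₊₁`. -/
noncomputable def cycleι (A : SimplicialObject C) (n : ℕ) : kernel (d A n) ⟶ A _⦋n + 1⦌ :=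
  kernel.ι (d A n) ≫ ι A (n + 1)

instance (A : SimplicialObject C) (n : ℕ) : Mono (cycleι A n) := mono_comp _ _

lemma cycleι_δ (A : SimplicialObject C) (n : ℕ) (i : Fin (n + 2)) : cycleι A n ≫ A.δ i = 0 := by
  rw [cycleι, Category.assoc]
  induction i using Fin.lastCases with
  | last => rw [← d_ι, kernel.condition_assoc, zero_comp]
  | cast i => rw [ι_δ, comp_zero]

lemma exists_lift_cycleι (A : SimplicialObject C) (n : ℕ) {T : C} (t : T ⟶ A _⦋n + 1⦌)
    (ht : ∀ i, t ≫ A.δ i = 0) : ∃ l, l ≫ cycleι A n = t := by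
  obtain ⟨l, hl⟩ := exists_lift_ι A n t fun i => ht _
  refine ⟨kernel.lift _ l ?_, by rw [cycleι, kernel.lift_ι_assoc, hl]⟩
  rw [← cancel_mono (ι A n), Category.assoc, d_ι, ← Category.assoc, hl, ht, zero_comp]

/-- The morphism from `Nₙ₊₂ A` to the cycles in degree `n + 1` induced by the boundary operator. -/
noncomputable def toCycles (A : SimplicialObject C) (n : ℕ) : N A (n + 2) ⟶ kernel (d A n) :=
  kernel.lift _ (d A (n + 1)) (d_comp_d A n)

lemma toCycles_cycleι (A : SimplicialObject C) (n : ℕ) :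
    toCycles A n ≫ cycleι A n = ι A (n + 2) ≫ A.δ (Fin.last (n + 2)) := by
  rw [toCycles, cycleι, kernel.lift_ι_assoc, d_ι]

/-- The object of homologies between cycles: the elements of `Aₙ₊₂` all of whose faces but the last
two vanish, and whose last two faces are cycles. -/
lemma exists_homologies (A : SimplicialObject C) (n : ℕ) :
    ∃ (W : C) (w : W ⟶ A _⦋n + 2⦌) (d₀ d₁ : W ⟶ kernel (d A n)), Mono w ∧
      (∀ i : Fin (n + 3), i.val ≤ n → w ≫ A.δ i = 0) ∧
      d₀ ≫ cycleι A n = w ≫ A.δ (Fin.last (n + 1)).castSucc ∧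
      d₁ ≫ cycleι A n = w ≫ A.δ (Fin.last (n + 2)) ∧
      ∀ {T : C} (t : T ⟶ A _⦋n + 2⦌), (∀ i : Fin (n + 3), i.val ≤ n → t ≫ A.δ i = 0) →
        (∀ j, (t ≫ A.δ (Fin.last (n + 1)).castSucc) ≫ A.δ j = 0) → ∃ l, l ≫ w = t := by
  obtain ⟨W, w, hw, h₁, h₂, h₃⟩ := exists_joint_kernel
    (fun i : {i : Fin (n + 3) // i.val ≤ n} => A.δ (n := n + 1) i.1)
    (fun j : Fin (n + 2) => A.δ (n := n + 1) (Fin.last (n + 1)).castSucc ≫ A.δ (n := n) j)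
  have h₁' : ∀ i : Fin (n + 3), i.val ≤ n → w ≫ A.δ i = 0 := fun i hi => h₁ ⟨i, hi⟩
  obtain ⟨d₀, hd₀⟩ := exists_lift_cycleι A n (w ≫ A.δ (Fin.last (n + 1)).castSucc)
    fun j => by rw [Category.assoc, h₂ j]
  -- The last face is automatically a cycle: ∂ⱼ∂ₙ₊₂ = ∂ₙ₊₁∂ⱼ for j ≤ n + 1.
  obtain ⟨d₁, hd₁⟩ := exists_lift_cycleι A n (w ≫ A.δ (Fin.last (n + 2))) fun j => by
    rw [Category.assoc, δ_comp_δ_of_val A (i' := j.castSucc) (j' := Fin.last (n + 1)) rfl rfl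
      (Fin.le_last j)]
    induction j using Fin.lastCases with
    | last => exact h₂ _
    | cast j => rw [← Category.assoc, h₁' _ (Nat.lt_succ_iff.1 j.2), zero_comp]
  exact ⟨W, w, d₀, d₁, hw, h₁', hd₀, hd₁, fun t ht ht' => h₃ t (fun i => ht i.1 i.2)
    fun j => by rw [← Category.assoc, ht' j]⟩

/-- The object of elements of `Aₙ₊₂` whose faces of index `< n` vanish and whose other faces are
cycles. -/
lemma exists_horns (A : SimplicialObject C) (n : ℕ) :
    ∃ (T : C) (t : T ⟶ A _⦋n + 2⦌) (e₀ e₁ e₂ : T ⟶ kernel (d A n)), Mono t ∧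
      (∀ i : Fin (n + 3), i.val < n → t ≫ A.δ i = 0) ∧
      e₀ ≫ cycleι A n = t ≫ A.δ (Fin.last n).castSucc.castSucc ∧
      e₁ ≫ cycleι A n = t ≫ A.δ (Fin.last (n + 1)).castSucc ∧
      e₂ ≫ cycleι A n = t ≫ A.δ (Fin.last (n + 2)) ∧
      ∀ {X : C} (x : X ⟶ A _⦋n + 2⦌), (∀ i : Fin (n + 3), i.val < n → x ≫ A.δ i = 0) →
        (∀ j, (x ≫ A.δ (Fin.last n).castSucc.castSucc) ≫ A.δ j = 0) →
        (∀ j, (x ≫ A.δ (Fin.last (n + 2))) ≫ A.δ j = 0) → ∃ l, l ≫ t = x := by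
  obtain ⟨T, t, ht, h₁, h₂, h₃⟩ := exists_joint_kernel
    (fun i : {i : Fin (n + 3) // i.val < n} => A.δ (n := n + 1) i.1)
    (fun j : Fin (n + 2) ⊕ Fin (n + 2) => j.elim
      (fun j => A.δ (n := n + 1) (Fin.last n).castSucc.castSucc ≫ A.δ (n := n) j)
      (fun j => A.δ (n := n + 1) (Fin.last (n + 2)) ≫ A.δ (n := n) j))
  have h₁' : ∀ i : Fin (n + 3), i.val < n → t ≫ A.δ i = 0 := fun i hi => h₁ ⟨i, hi⟩
  obtain ⟨e₀, he₀⟩ := exists_lift_cycleι A n (t ≫ A.δ (Fin.last n).castSucc.castSucc)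
    fun j => by rw [Category.assoc]; exact h₂ (Sum.inl j)
  obtain ⟨e₂, he₂⟩ := exists_lift_cycleι A n (t ≫ A.δ (Fin.last (n + 2)))
    fun j => by rw [Category.assoc]; exact h₂ (Sum.inr j)
  -- The middle face is a cycle because the outer two are: ∂ₙ₊₁∂ₙ₊₁ = ∂ₙ₊₁∂ₙ₊₂, and ∂ⱼ∂ₙ₊₁ = ∂ₙ∂ⱼ
  -- for j ≤ n.
  obtain ⟨e₁, he₁⟩ := exists_lift_cycleι A n (t ≫ A.δ (Fin.last (n + 1)).castSucc) fun j => by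
    rw [Category.assoc]
    induction j using Fin.lastCases with
    | last =>
      rw [← δ_comp_δ_of_val A (j := Fin.last (n + 2)) (i := Fin.last (n + 1)) rfl rfl le_rfl]
      exact h₂ (Sum.inr _)
    | cast j =>
      rw [δ_comp_δ_of_val A (i' := j.castSucc.castSucc) (j' := (Fin.last n).castSucc) rfl rfl
        (Fin.le_last j)]
      induction j using Fin.lastCases with
      | last => exact h₂ (Sum.inl _)
      | cast j => rw [← Category.assoc, h₁' _ j.2, zero_comp]
  refine ⟨T, t, e₀, e₁, e₂, ht, h₁', he₀, he₁, he₂, fun x hx hx₀ hx₂ =>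
    h₃ x (fun i => hx i.1 i.2) ?_⟩
  rintro (j | j)
  · exact (Category.assoc _ _ _).symm.trans (hx₀ j)
  · exact (Category.assoc _ _ _).symm.trans (hx₂ j)

end Moore

/-! ### Homology as a reflexive coequalizer, and its abelianness -/

namespace Moore

variable {C : Type u} [Category.{v} C] [HasZeroMorphisms C] [IsSemiAbelian C]

/-- The cokernel of `Nₙ₊₂ A ⟶ K[dₙ₊₁]` exists and is abelian. -/
lemma exists_cokernel_toCycles (A : SimplicialObject C) (n : ℕ) :
    ∃ (H : C) (q : kernel (d A n) ⟶ H), Epi q ∧ toCycles A n ≫ q = 0 ∧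
      (∀ {Y : C} (f : kernel (d A n) ⟶ Y), toCycles A n ≫ f = 0 → ∃ g, q ≫ g = f) ∧
      IsAbelianObject H := by
  have : HasZeroObject C := IsSemiAbelian.hasZeroObject
  obtain ⟨W, w, d₀, d₁, hw, hw₁, hd₀, hd₁, hwl⟩ := exists_homologies A n
  have hz := cycleι_δ A n
  obtain ⟨s, hs⟩ := hwl (cycleι A n ≫ A.σ (Fin.last (n + 1)))
    (fun i hi => comp_σ_comp_δ_eq_zero A hz (by simp [Fin.ext_iff]; lia)
      (by simp [Fin.ext_iff]; lia))
    (fun j => by rw [comp_σ_comp_δ A _ (Or.inl rfl), hz])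
  have hs₀ : s ≫ d₀ = 𝟙 _ := by
    rw [← cancel_mono (cycleι A n), Category.assoc, hd₀, ← Category.assoc s, hs,
        comp_σ_comp_δ A _ (Or.inl rfl), Category.id_comp]
  have hs₁ : s ≫ d₁ = 𝟙 _ := by
    rw [← cancel_mono (cycleι A n), Category.assoc, hd₁, ← Category.assoc s, hs,
        comp_σ_comp_δ A _ (Or.inr (Fin.succ_last _).symm), Category.id_comp]
  obtain ⟨H, q, hq, hqw, hql⟩ := IsBarrExact.exists_coequalizer_of_reflexive d₀ d₁ s hs₀ hs₁
  refine ⟨H, q, inferInstance, ?_, fun f hf => hql f ?_, ?_⟩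
  -- Nₙ₊₂A sits in W, with `d₀` zero and `d₁` equal to `toCycles`.
  · have hι : ∀ i : Fin (n + 2), ι A (n + 2) ≫ A.δ i.castSucc = 0 := ι_δ A (n + 1)
    obtain ⟨l, hl⟩ := hwl (ι A (n + 2)) (fun i hi => hι (i.castLT (by lia)))
      (fun j => by rw [hι, zero_comp])
    have h₀ : l ≫ d₀ = 0 := by
      rw [← cancel_mono (cycleι A n), Category.assoc, hd₀, reassoc_of% hl, hι, zero_comp]
    have h₁ : l ≫ d₁ = toCycles A n := by
      rw [← cancel_mono (cycleι A n), Category.assoc, hd₁, reassoc_of% hl, toCycles_cycleι]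
    rw [← h₁, Category.assoc, ← hqw, reassoc_of% h₀, zero_comp]
  -- Conversely, the kernel of `d₀` lands in Nₙ₊₂A; on the section both legs are the identity.
  · refine IsProtomodular.hom_ext hs₀ ?_ (by rw [reassoc_of% hs₀, reassoc_of% hs₁])
    obtain ⟨l, hl⟩ := exists_lift_ι A (n + 1) (kernel.ι d₀ ≫ w) fun i => by
      rw [Category.assoc]
      induction i using Fin.lastCases with
      | last => rw [← hd₀, kernel.condition_assoc, zero_comp]
      | cast i => rw [hw₁ _ (Nat.lt_succ_iff.1 i.2), comp_zero]
    have h₁ : l ≫ toCycles A n = kernel.ι d₀ ≫ d₁ := by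
      rw [← cancel_mono (cycleι A n), Category.assoc, Category.assoc, toCycles_cycleι, hd₁,
        reassoc_of% hl]
    rw [kernel.condition_assoc, zero_comp, ← Category.assoc, ← h₁, Category.assoc, hf, comp_zero]
  · obtain ⟨T, t, e₀, e₁, e₂, ht, ht₁, he₀, he₁, he₂, htl⟩ := exists_horns A n
    -- σₙ₊₁ gives `a` with last three faces (0, 1, 1); σₙ gives `b` with (1, 1, 0).
    obtain ⟨a, ha⟩ := htl (cycleι A n ≫ A.σ (Fin.last (n + 1)))
      (fun i hi => comp_σ_comp_δ_eq_zero A hz (by simp [Fin.ext_iff]; lia)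
        (by simp [Fin.ext_iff]; lia))
      (fun j => by
        rw [comp_σ_comp_δ_eq_zero A hz (by simp [Fin.ext_iff]) (by simp [Fin.ext_iff]; lia),
          zero_comp])
      (fun j => by rw [comp_σ_comp_δ A _ (Or.inr (Fin.succ_last _).symm), hz])
    obtain ⟨b, hb⟩ := htl (cycleι A n ≫ A.σ (Fin.last n).castSucc)
      (fun i hi => comp_σ_comp_δ_eq_zero A hz (by simp [Fin.ext_iff]; lia)
        (by simp [Fin.ext_iff]; lia))
      (fun j => by rw [comp_σ_comp_δ A _ (Or.inl rfl), hz])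
      (fun j => by
        rw [comp_σ_comp_δ_eq_zero A hz (by simp [Fin.ext_iff]) (by simp [Fin.ext_iff]),
          zero_comp])
    have ha₀ : a ≫ e₀ = 0 := by
      rw [← cancel_mono (cycleι A n), Category.assoc, he₀, ← Category.assoc a, ha,
        comp_σ_comp_δ_eq_zero A hz (by simp [Fin.ext_iff]) (by simp [Fin.ext_iff]; lia),
        zero_comp]
    have ha₁ : a ≫ e₁ = 𝟙 _ := by
      rw [← cancel_mono (cycleι A n), Category.assoc, he₁, ← Category.assoc a, ha,
        comp_σ_comp_δ A _ (Or.inl rfl), Category.id_comp]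
    have ha₂ : a ≫ e₂ = 𝟙 _ := by
      rw [← cancel_mono (cycleι A n), Category.assoc, he₂, ← Category.assoc a, ha,
        comp_σ_comp_δ A _ (Or.inr (Fin.succ_last _).symm), Category.id_comp]
    have hb₀ : b ≫ e₀ = 𝟙 _ := by
      rw [← cancel_mono (cycleι A n), Category.assoc, he₀, ← Category.assoc b, hb,
        comp_σ_comp_δ A _ (Or.inl rfl), Category.id_comp]
    have hb₁ : b ≫ e₁ = 𝟙 _ := by
      rw [← cancel_mono (cycleι A n), Category.assoc, he₁, ← Category.assoc b, hb,
        comp_σ_comp_δ A _ (j := (Fin.last n).castSucc) (i := (Fin.last (n + 1)).castSucc)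
          (Or.inr rfl), Category.id_comp]
    have hb₂ : b ≫ e₂ = 0 := by
      rw [← cancel_mono (cycleι A n), Category.assoc, he₂, ← Category.assoc b, hb,
        comp_σ_comp_δ_eq_zero A hz (by simp [Fin.ext_iff]) (by simp [Fin.ext_iff]),
        zero_comp]
    have ha' : a ≫ prod.lift e₂ e₀ = prod.lift (𝟙 _) 0 := by ext <;> simp [ha₀, ha₂]
    have hb' : b ≫ prod.lift e₂ e₀ = prod.lift 0 (𝟙 _) := by ext <;> simp [hb₀, hb₂]
    have hreg := IsProtomodular.isRegularEpi_of_prod (prod.lift e₂ e₀) ha' hb'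
    obtain ⟨φ, hφ⟩ := IsProtomodular.exists_desc (prod.lift e₂ e₀) (e₁ ≫ q) (by
      set k := kernel.ι (prod.lift e₂ e₀)
      have hk₂ : k ≫ e₂ = 0 := by
        have h := kernel.condition (prod.lift e₂ e₀) =≫ prod.fst
        rwa [Category.assoc, prod.lift_fst, zero_comp] at h
      have hk₀ : k ≫ e₀ = 0 := by
        have h := kernel.condition (prod.lift e₂ e₀) =≫ prod.snd
        rwa [Category.assoc, prod.lift_snd, zero_comp] at h
      -- With both outer faces zero, an element of T is a homology from its middle face to 0.
      obtain ⟨l, hl⟩ := hwl (k ≫ t)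
        (fun i hi => by
          rw [Category.assoc]
          rcases hi.lt_or_eq with hi | hi
          · rw [ht₁ i hi, comp_zero]
          · obtain rfl : i = (Fin.last n).castSucc.castSucc := Fin.ext hi
            rw [← he₀, reassoc_of% hk₀, zero_comp])
        (fun j => by rw [Category.assoc k, ← he₁, Category.assoc, Category.assoc, hz, comp_zero,
          comp_zero])
      have h₀ : l ≫ d₀ = k ≫ e₁ := by
        rw [← cancel_mono (cycleι A n), Category.assoc, hd₀, reassoc_of% hl, Category.assoc, he₁]
      have h₁ : l ≫ d₁ = 0 := by
        rw [← cancel_mono (cycleι A n), Category.assoc, hd₁, reassoc_of% hl, ← he₂,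
          reassoc_of% hk₂, zero_comp]
      rw [← Category.assoc, ← h₀, Category.assoc, hqw, reassoc_of% h₁, zero_comp])
    exact Cooperate.isAbelianObject (q := q) ⟨φ,
      by rw [← ha', Category.assoc, hφ, reassoc_of% ha₁],
      by rw [← hb', Category.assoc, hφ, reassoc_of% hb₁]⟩

/-- The short complex of the Moore complex around degree `n + 1`. -/
noncomputable def scIso (A : SimplicialObject C) (n : ℕ) :
    ShortComplex.mk (d A (n + 1)) (d A n) (d_comp_d A n) ≅ sc A (n + 1) :=
  (ShortComplex.isoMk (S₁ := (complex A).sc' (n + 2) (n + 1) n)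
    (S₂ := ShortComplex.mk (d A (n + 1)) (d A n) (d_comp_d A n))
    (Iso.refl _) (Iso.refl _) (Iso.refl _)
    ((Category.id_comp _).trans
      ((ChainComplex.of_d (N A) (d A) (n + 1)).symm.trans (Category.comp_id _).symm))
    ((Category.id_comp _).trans
      ((ChainComplex.of_d (N A) (d A) n).symm.trans (Category.comp_id _).symm))).symm ≪≫
    ((complex A).isoSc' (n + 2) (n + 1) n (by simp) (by simp)).symm

end Moore

/-- For every simplicial object `A` in a semi-abelian category and every `n ≥ 1`, the homology
object `Hₙ A` exists and is an abelian object. -/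
theorem mainTheorem4 {C : Type u} [Category.{v} C] [HasZeroMorphisms C] [IsSemiAbelian C]
    (A : SimplicialObject C) (n : ℕ) (hn : 1 ≤ n) :
    ∃ _ : (Moore.sc A n).HasLeftHomology, IsAbelianObject (homologyObject A n) := by
  obtain ⟨m, rfl⟩ := Nat.exists_eq_add_of_le' hn
  obtain ⟨H, q, hq, hw, hl, hH⟩ := Moore.exists_cokernel_toCycles A m
  let h₀ : (ShortComplex.mk (Moore.d A (m + 1)) (Moore.d A m)
      (Moore.d_comp_d A m)).LeftHomologyData :=
    { K := kernel (Moore.d A m)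
      H := H
      i := kernel.ι _
      π := q
      wi := kernel.condition _
      hi := kernelIsKernel _
      wπ := hw
      hπ := CokernelCofork.IsColimit.ofπ _ _ (fun f hf => (hl f hf).choose)
        (fun f hf => (hl f hf).choose_spec)
        (fun f hf g hg => by rw [← cancel_epi q, hg, (hl f hf).choose_spec]) }
  let h := ShortComplex.LeftHomologyData.ofIso (Moore.scIso A m) h₀
  have : (Moore.sc A (m + 1)).HasLeftHomology := ⟨⟨h⟩⟩
  exact ⟨this, IsAbelianObject.of_iso h.leftHomologyIso.symm hH⟩
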